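/- Setting. Consider first-order logic without equality (formulas built from $\top$, $\bot$ and predications by $\neg$, $\wedge$, $\exists x$), over a language in which every function symbol (constants included) is designated as rigid or non-rigid. A *modal structure* $M=(W,D,I)$ has a set $W$ of worlds, a constant nonempty domain $D$, and for every world an interpretation of the symbols on $D$, such that every rigid function symbol has the same extension in all worlds. A *question* $?\varphi$ is given by a formula $\varphi$, possibly with free variables, and expresses the equivalence relation $[?\varphi]_M=\{(w,v)\in W^2 : \forall g\ (M,w,g\models\varphi \Leftrightarrow M,v,g\models\varphi)\}$; we write $?\varphi\models{?\psi}$ if $[?\varphi]_M\subseteq[?\psi]_M$ for all $M$. A sentence $\psi$ is an *answer* to $?\varphi$ if $?\varphi\models{?\psi}$. Given a theory (set of sentences) $\Sigma$, a sentence $\psi$ is *the most specific answer to $?\varphi$ entailed by $\Sigma$* if $\psi$ is an answer to $?\varphi$, $\Sigma\models\psi$, and $\psi\models\psi'$ for every answer $\psi'$ to $?\varphi$ with $\Sigma\models\psi'$. Theorem. 1. Let $\Sigma$ be a theory, in any language without equality, that contains no rigid function symbols. Then $\Sigma$ is satisfiable if and only if $\top$ is the most specific answer to $?\top$ entailed by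 $\Sigma$. 2. Consider the full countable language without equality, which for every arity has infinitely many predicate symbols, infinitely many rigid function symbols and infinitely many non-rigid function symbols, with its formulas coded effectively by natural numbers. It is undecidable whether a given sentence is the most specific answer to a given question entailed by a given theory: there is no computable function that, for every finite theory $\Sigma$, formula $\varphi$ and sentence $\psi$, decides whether $\psi$ is the most specific answer to $?\varphi$ entailed by $\Sigma$. 3. This is already undecidable for the instances in 1: there is no computable function that, for every finite theory $\Sigma$ in that language without rigid function symbols, decides whether $\top$ is the most specific answer to $?\top$ entailed by $\Sigma$. -/

import Mathlib

universe u v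

namespace Answerhood

/-- First-order formulas without equality over the language `L`, with named variables in `ℕ`.
The primitives are `⊤`, `⊥`, predications, negation, conjunction and existential quantification. -/
inductive Formula (L : FirstOrder.Language.{u, v}) : Type (max u v)
  | top : Formula L
  | bot : Formula L
  | rel {n : ℕ} (P : L.Relations n) (ts : Fin n → L.Term ℕ) : Formula L
  | neg (φ : Formula L) : Formula L
  | and (φ ψ : Formula L) : Formula L
  | ex (x : ℕ) (φ : Formula L) : Formula L

/-- The function symbols (constants included) that occur in a term. -/
def termFuncs {L : FirstOrder.Language.{u, v}} : L.Term ℕ → Set (Σ n, L.Functions n)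
  | .var _ => ∅
  | .func f ts => {⟨_, f⟩} ∪ ⋃ i, termFuncs (ts i)

namespace Formula

variable {L : FirstOrder.Language.{u, v}}

/-- The free variables of a formula. -/
def freeVars : Formula L → Finset ℕ
  | top => ∅
  | bot => ∅
  | rel _ ts => Finset.univ.biUnion fun i => (ts i).varFinset
  | neg φ => φ.freeVars
  | and φ ψ => φ.freeVars ∪ ψ.freeVars
  | ex x φ => φ.freeVars.erase x

/-- A formula without free variables. -/
def IsSentence (φ : Formula L) : Prop := φ.freeVars = ∅

/-- The function symbols (constants included) that occur in a formula. -/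
def funcs : Formula L → Set (Σ n, L.Functions n)
  | top => ∅
  | bot => ∅
  | rel _ ts => ⋃ i, termFuncs (ts i)
  | neg φ => φ.funcs
  | and φ ψ => φ.funcs ∪ ψ.funcs
  | ex _ φ => φ.funcs

/-- Truth of a formula under an assignment `g`. The structure is an explicit argument, because a
modal model carries one structure for every world. -/
def Realize {D : Type*} (I : L.Structure D) : Formula L → (ℕ → D) → Prop
  | top, _ => True
  | bot, _ => False
  | rel P ts, g => I.RelMap P fun i => (ts i).realize g
  | neg φ, g => ¬ φ.Realize I g
  | and φ ψ, g => φ.Realize I g ∧ ψ.Realize I g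
  | ex x φ, g => ∃ d : D, φ.Realize I (Function.update g x d)

end Formula

section Semantics

variable {L : FirstOrder.Language.{u, v}}

/-- The structure `I` on `D` is a model of the set of formulas `T`. -/
def IsModel {D : Type*} (I : L.Structure D) (T : Set (Formula L)) : Prop :=
  ∀ φ ∈ T, ∀ g : ℕ → D, φ.Realize I g

/-- `T` has a first-order model (with nonempty domain). -/
def Satisfiable (T : Set (Formula L)) : Prop :=
  ∃ (D : Type (max u v)) (_ : Nonempty D) (I : L.Structure D), IsModel I T

/-- First-order entailment `T ⊨ ψ`: every model of `T` is a model of `ψ`. -/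
def Entails (T : Set (Formula L)) (ψ : Formula L) : Prop :=
  ∀ (D : Type (max u v)) (_ : Nonempty D) (I : L.Structure D),
    IsModel I T → IsModel I {ψ}

/-- A first-order modal structure `(W, D, I)` with constant domain `D`, in which the function
symbols in `R` (the rigid ones) have the same extension in every world. -/
structure ModalModel (L : FirstOrder.Language.{u, v}) (R : Set (Σ n, L.Functions n)) where
  World : Type (max u v)
  Domain : Type (max u v)
  domain_nonempty : Nonempty Domain
  interp : World → L.Structure Domain
  rigid : ∀ (n : ℕ) (f : L.Functions n), (⟨n, f⟩ : Σ n, L.Functions n) ∈ R →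
    ∀ (w w' : World) (a : Fin n → Domain), (interp w).funMap f a = (interp w').funMap f a

variable {R : Set (Σ n, L.Functions n)}

/-- The partition (equivalence relation) `[?φ]_M` that a question expresses on the worlds. -/
def ModalModel.partition (M : ModalModel L R) (φ : Formula L) : Set (M.World × M.World) :=
  {p | ∀ g : ℕ → M.Domain, φ.Realize (M.interp p.1) g ↔ φ.Realize (M.interp p.2) g}

/-- Entailment between questions, `?φ ⊨ ?ψ`. -/
def QuestionEntails (R : Set (Σ n, L.Functions n)) (φ ψ : Formula L) : Prop :=
  ∀ M : ModalModel L R, M.partition φ ⊆ M.partition ψ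

/-- `ψ` is an answer to `?φ`. -/
def IsAnswer (R : Set (Σ n, L.Functions n)) (φ ψ : Formula L) : Prop :=
  ψ.IsSentence ∧ QuestionEntails R φ ψ

/-- `ψ` is the most specific (most informative, optimal) answer to `?φ` entailed by `T`. -/
def IsMostSpecificAnswer (R : Set (Σ n, L.Functions n)) (T : Set (Formula L))
    (φ ψ : Formula L) : Prop :=
  IsAnswer R φ ψ ∧ Entails T ψ ∧
    ∀ ψ' : Formula L, IsAnswer R φ ψ' → Entails T ψ' → Entails {ψ} ψ'

/-- `T` is a theory, that is, a set of sentences. -/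
def IsTheory (T : Set (Formula L)) : Prop := ∀ σ ∈ T, σ.IsSentence

/-- No rigid function symbol occurs in `T`. -/
def NoRigid (R : Set (Σ n, L.Functions n)) (T : Set (Formula L)) : Prop :=
  ∀ σ ∈ T, Disjoint σ.funcs R

end Semantics

section Coding

/-- The full countable language: for every arity infinitely many predicate symbols `k`,
infinitely many rigid function symbols `inl k` and infinitely many non-rigid function
symbols `inr k`; those of arity `0` are the constants. -/
abbrev fullLang : FirstOrder.Language.{0, 0} where
  Functions _ := ℕ ⊕ ℕ
  Relations _ := ℕ

/-- The rigid function symbols of `fullLang`. -/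
def fullRigid : Set (Σ n, fullLang.Functions n) := {f | ∃ k : ℕ, f.2 = Sum.inl k}

open Encodable Denumerable

/-- The Gödel number of a term. -/
def encodeTerm : fullLang.Term ℕ → ℕ
  | .var x => 2 * x
  | .func f ts =>
      2 * Nat.pair (encode (α := ℕ ⊕ ℕ) f) (encode (List.ofFn fun i => encodeTerm (ts i))) + 1

theorem mem_lt_encode {a : ℕ} : ∀ {l : List ℕ}, a ∈ l → a < encode l
  | [], h => by simp at h
  | b :: l, h => by
      rw [encode_list_cons]
      rcases List.mem_cons.1 h with h | h
      · subst h
        exact Nat.lt_succ_of_le (Nat.left_le_pair _ _)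
      · exact (mem_lt_encode h).trans_le ((Nat.right_le_pair _ _).trans (Nat.le_succ _))

theorem getElem_ofNat_lt {n i : ℕ} (h : i < (ofNat (List ℕ) n).length) :
    (ofNat (List ℕ) n)[i] < n := by
  have := mem_lt_encode (List.getElem_mem h)
  rwa [encode_ofNat] at this

/-- The term with a given Gödel number. -/
def decodeTerm (n : ℕ) : fullLang.Term ℕ :=
  if n % 2 = 0 then .var (n / 2)
  else .func (l := (ofNat (List ℕ) (n / 2).unpair.2).length)
    (ofNat (ℕ ⊕ ℕ) (n / 2).unpair.1)
    (fun i => decodeTerm (ofNat (List ℕ) (n / 2).unpair.2)[i])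
termination_by n
decreasing_by
  have h1 := getElem_ofNat_lt i.2
  have h2 := Nat.unpair_right_le (n / 2)
  simp only [Fin.getElem_fin]
  omega

theorem func_congr {L : FirstOrder.Language.{u, v}} {m n : ℕ} (h : m = n) {f : L.Functions m}
    {g : L.Functions n} (hf : f ≍ g) {ts : Fin m → L.Term ℕ} {us : Fin n → L.Term ℕ}
    (ht : ∀ i : Fin m, ts i = us (Fin.cast h i)) :
    FirstOrder.Language.Term.func f ts = FirstOrder.Language.Term.func g us := by
  subst h
  cases hf
  congr 1
  exact funext ht

theorem decodeTerm_encodeTerm (t : fullLang.Term ℕ) : decodeTerm (encodeTerm t) = t := by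
  induction t with
  | var x => rw [encodeTerm, decodeTerm]; simp
  | @func l f ts ih =>
    rw [encodeTerm, decodeTerm, if_neg (by omega)]
    have h : ∀ m : ℕ, (2 * m + 1) / 2 = m := fun m => by omega
    refine func_congr ?_ ?_ ?_
    · simp [h]
    · simp [h]
    · intro i
      simp only [Fin.getElem_fin, List.getElem_ofFn, h, Nat.unpair_pair, ofNat_encode, ih]
      rfl

theorem encodeTerm_decodeTerm (n : ℕ) : encodeTerm (decodeTerm n) = n := by
  induction n using Nat.strong_induction_on with
  | _ n ih =>
    rw [decodeTerm]
    split_ifs with h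
    · rw [encodeTerm]; omega
    · rw [encodeTerm]
      have : ∀ (i : ℕ) (h : i < (ofNat (List ℕ) (n / 2).unpair.2).length),
          encodeTerm (decodeTerm (ofNat (List ℕ) (n / 2).unpair.2)[i]) =
            (ofNat (List ℕ) (n / 2).unpair.2)[i] := fun i h => ih _ (by
          have h1 := getElem_ofNat_lt h
          have h2 := Nat.unpair_right_le (n / 2)
          omega)
      simp only [Fin.getElem_fin, this, List.ofFn_getElem, encode_ofNat, Nat.pair_unpair]
      omega

/-- The Gödel number of a formula. -/
def encodeFormula : Formula fullLang → ℕ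
  | .top => 0
  | .bot => 1
  | .rel P ts => 4 * Nat.pair P (encode (List.ofFn fun i => encodeTerm (ts i))) + 2
  | .neg φ => 4 * encodeFormula φ + 3
  | .and φ ψ => 4 * Nat.pair (encodeFormula φ) (encodeFormula ψ) + 4
  | .ex x φ => 4 * Nat.pair x (encodeFormula φ) + 5

/-- The formula with a given Gödel number. -/
def decodeFormula : ℕ → Formula fullLang
  | 0 => .top
  | 1 => .bot
  | n + 2 =>
    if n % 4 = 0 then
      .rel (n := (ofNat (List ℕ) (n / 4).unpair.2).length) (n / 4).unpair.1
        (fun i => decodeTerm (ofNat (List ℕ) (n / 4).unpair.2)[i])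
    else if n % 4 = 1 then .neg (decodeFormula (n / 4))
    else if n % 4 = 2 then
      .and (decodeFormula (n / 4).unpair.1) (decodeFormula (n / 4).unpair.2)
    else .ex (n / 4).unpair.1 (decodeFormula (n / 4).unpair.2)
termination_by n => n
decreasing_by
  all_goals
    have h1 := Nat.unpair_left_le (n / 4)
    have h2 := Nat.unpair_right_le (n / 4)
    omega

theorem rel_congr {L : FirstOrder.Language.{u, v}} {m n : ℕ} (h : m = n) {P : L.Relations m}
    {Q : L.Relations n} (hP : P ≍ Q) {ts : Fin m → L.Term ℕ} {us : Fin n → L.Term ℕ}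
    (ht : ∀ i : Fin m, ts i = us (Fin.cast h i)) : Formula.rel P ts = Formula.rel Q us := by
  subst h
  cases hP
  congr 1
  exact funext ht

theorem decodeFormula_encodeFormula (φ : Formula fullLang) :
    decodeFormula (encodeFormula φ) = φ := by
  have h1 : ∀ m : ℕ, (4 * m + 1) / 4 = m := fun m => by omega
  have h2 : ∀ m : ℕ, (4 * m + 2) / 4 = m := fun m => by omega
  have h3 : ∀ m : ℕ, (4 * m + 3) / 4 = m := fun m => by omega
  induction φ with
  | top => rw [encodeFormula, decodeFormula]
  | bot => rw [encodeFormula, decodeFormula]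
  | rel P ts =>
    rw [encodeFormula, decodeFormula, if_pos (by omega)]
    refine rel_congr ?_ ?_ ?_
    · simp
    · simp
    · intro i
      simp [decodeTerm_encodeTerm]
      rfl
  | neg φ ih =>
    rw [encodeFormula, decodeFormula, if_neg (by omega), if_pos (by omega), h1, ih]
  | and φ ψ ih1 ih2 =>
    rw [encodeFormula, decodeFormula, if_neg (by omega), if_neg (by omega), if_pos (by omega), h2,
      Nat.unpair_pair, ih1, ih2]
  | ex x φ ih =>
    rw [encodeFormula, decodeFormula, if_neg (by omega), if_neg (by omega), if_neg (by omega), h3,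
      Nat.unpair_pair, ih]

theorem encodeFormula_decodeFormula (n : ℕ) : encodeFormula (decodeFormula n) = n := by
  induction n using Nat.strong_induction_on with
  | _ n ih =>
    match n, ih with
    | 0, _ => rw [decodeFormula, encodeFormula]
    | 1, _ => rw [decodeFormula, encodeFormula]
    | n + 2, ih =>
      have h1 := Nat.unpair_left_le (n / 4)
      have h2 := Nat.unpair_right_le (n / 4)
      rw [decodeFormula]
      split_ifs with h h' h''
      · rw [encodeFormula]
        simp only [encodeTerm_decodeTerm, Fin.getElem_fin, List.ofFn_getElem, encode_ofNat,
          Nat.pair_unpair]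
        omega
      · rw [encodeFormula, ih _ (by omega)]; omega
      · rw [encodeFormula, ih _ (by omega), ih _ (by omega), Nat.pair_unpair]; omega
      · rw [encodeFormula, ih _ (by omega), Nat.pair_unpair]; omega

/-- Gödel numbering of the formulas. Through it, Mathlib's notion of a computable function applies
to formulas, finite lists of formulas, and tuples of these. -/
instance : Denumerable (Formula fullLang) :=
  Denumerable.mk'
    ⟨encodeFormula, decodeFormula, decodeFormula_encodeFormula, encodeFormula_decodeFormula⟩

end Coding

end Answerhood

namespace Answerhood

/-! ### Satisfiability as most specific answerhood: the product of two models. -/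

section Transfer

variable {L : FirstOrder.Language.{u, v}}

/-! Any two worlds agree on `?⊤`, so an answer to it cannot change its truth value within a modal
model. Let `ψ` be such an answer, entailed by a theory with a model `I`, and let `J` be any
structure. On the product of the two domains, one world imitates `I` through the first projection
and another imitates `J` through the second (`productModel`). Without equality, formulas cannot tell
the product from its factors (`realize_iff_of_surjective`). So `ψ` passes from the first world to
the second and holds in `J`: it is valid. Conversely, an unsatisfiable theory entails the answer
`⊥`, which `⊤` does not entail.

Undecidability then follows from that of satisfiability. A partial recursive code is described by
Horn clauses over non-rigid zero and successor, with one binary predicate for the graph of each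
code. A halting computation is a derivation from these clauses (`evalOf_of_valid`), while the
natural numbers are a model of them; adding that the code has no value at a numeral gives a theory
that is satisfiable exactly when the computation diverges (`satisfiable_divergenceTheory`). With a
fixed universal code, only one sentence of the theory varies with the input, and the halting problem
reduces to satisfiability. -/

/-- A surjection that commutes with the function symbols in `F` and preserves and reflects all
predicates preserves and reflects the formulas whose function symbols are in `F`. -/
theorem realize_iff_of_surjective {D E : Type*} (I : L.Structure D) (J : L.Structure E)
    (h : D → E) (hs : Function.Surjective h) (F : Set (Σ n, L.Functions n))
    (hf : ∀ (n : ℕ) (f : L.Functions n), (⟨n, f⟩ : Σ n, L.Functions n) ∈ F →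
      ∀ a : Fin n → D, h (I.funMap f a) = J.funMap f (h ∘ a))
    (hr : ∀ (n : ℕ) (P : L.Relations n) (a : Fin n → D),
      I.RelMap P a ↔ J.RelMap P (h ∘ a))
    (φ : Formula L) (hφ : φ.funcs ⊆ F) (g : ℕ → D) :
    φ.Realize I g ↔ φ.Realize J (h ∘ g) := by
  have ht : ∀ t : L.Term ℕ, termFuncs t ⊆ F → ∀ g : ℕ → D,
      h (t.realize g) = t.realize (h ∘ g) := by
    intro t ht g
    induction t with
    | var x => rfl
    | func f ts ih =>
      simp only [termFuncs, Set.union_subset_iff, Set.singleton_subset_iff,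
        Set.iUnion_subset_iff] at ht
      simp only [FirstOrder.Language.Term.realize]
      rw [hf _ _ ht.1]
      congr 1
      exact funext fun i => ih i (ht.2 i)
  induction φ generalizing g with
  | top => rfl
  | bot => rfl
  | rel P ts =>
    simp only [Formula.funcs, Set.iUnion_subset_iff] at hφ
    simp only [Formula.Realize]
    rw [hr]
    have : (h ∘ fun i => (ts i).realize g) = fun i => (ts i).realize (h ∘ g) :=
      funext fun i => ht _ (hφ i) g
    rw [this]
  | neg φ ih => exact not_congr (ih hφ g)
  | and φ ψ ih1 ih2 =>
    simp only [Formula.funcs, Set.union_subset_iff] at hφ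
    exact and_congr (ih1 hφ.1 g) (ih2 hφ.2 g)
  | ex x φ ih =>
    simp only [Formula.Realize]
    -- Surjectivity pulls a witness in `E` back to `D`; injectivity would matter only for equality
    -- atoms.
    rw [hs.exists]
    refine exists_congr fun d => (ih hφ _).trans ?_
    rw [Function.comp_update]

variable {R : Set (Σ n, L.Functions n)} {T : Set (Formula L)}

open Classical in
/-- On the product of the domains of `I` and `J`, a modal model with a world that looks like `I`
as far as non-rigid symbols are concerned, and a world that looks like `J`. -/
noncomputable def productModel (R : Set (Σ n, L.Functions n)) {D E : Type (max u v)}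
    [Nonempty D] [Nonempty E] (I : L.Structure D) (J : L.Structure E) : ModalModel L R where
  World := ULift Bool
  Domain := D × E
  domain_nonempty := inferInstance
  interp w :=
    { funMap := fun {n} f a =>
        -- Functions ignore the world `w`; only predicates depend on it. The first coordinate given
        -- to a rigid symbol is a dummy, since the first projection is only required to respect
        -- non-rigid symbols.
        if (⟨n, f⟩ : Σ n, L.Functions n) ∈ R then
          (Classical.arbitrary D, J.funMap f (Prod.snd ∘ a))
        else (I.funMap f (Prod.fst ∘ a), J.funMap f (Prod.snd ∘ a))
      RelMap := fun P a =>
        if w.down then I.RelMap P (Prod.fst ∘ a) else J.RelMap P (Prod.snd ∘ a) }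
  rigid _ _ _ _ _ _ := rfl

theorem isAnswer_top {φ : Formula L} : IsAnswer R φ .top :=
  ⟨rfl, fun _ _ _ _ => Iff.rfl⟩

theorem isAnswer_bot {φ : Formula L} : IsAnswer R φ .bot :=
  ⟨rfl, fun _ _ _ _ => Iff.rfl⟩

open Classical in
/-- An answer to the trivial question that is entailed by a satisfiable theory without rigid
function symbols is valid. -/
theorem entails_top_of_isAnswer_top (hR : NoRigid R T) (hT : Satisfiable T) {ψ : Formula L}
    (hψ : IsAnswer R .top ψ) (h : Entails T ψ) : Entails {.top} ψ := by
  obtain ⟨D, _, I, hI⟩ := hT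
  intro E _ J _ χ hχ g
  obtain rfl : χ = ψ := hχ
  let M := productModel R I J
  have hfst : IsModel (M.interp ⟨true⟩) T := fun σ hσ k =>
    (realize_iff_of_surjective (M.interp ⟨true⟩) I Prod.fst Prod.fst_surjective Rᶜ
      (fun n f hf a => by
        have hf' : (⟨n, f⟩ : Σ n, L.Functions n) ∉ R := hf
        change (ite _ _ _ : D × E).1 = _
        rw [if_neg hf']
        exact rfl)
      (fun n P a => by
        change (ite _ _ _ : Prop) ↔ _
        rw [if_pos rfl]
        exact Iff.rfl)
      σ (Set.disjoint_left.1 (hR σ hσ)) k).2 (hI σ hσ _)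
  have h1 := h _ M.domain_nonempty _ hfst χ rfl
  -- The trivial question does not separate the two worlds, so the answer keeps its truth value.
  have h2 : ∀ k, χ.Realize (M.interp ⟨false⟩) k := fun k =>
    (hψ.2 M (show ((⟨true⟩, ⟨false⟩) : M.World × M.World) ∈ M.partition .top from
      fun _ => Iff.rfl) k).1 (h1 k)
  -- The second projection respects every function symbol, so rigid symbols may occur in `χ`.
  have h3 := (realize_iff_of_surjective (M.interp ⟨false⟩) J Prod.snd Prod.snd_surjective
    Set.univ
    (fun n f _ a => by
      change (ite _ _ _ : D × E).2 = _
      split_ifs <;> rfl)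
    (fun n P a => by
      change (ite _ _ _ : Prop) ↔ _
      rw [if_neg Bool.false_ne_true]
      exact Iff.rfl)
    χ (Set.subset_univ _) fun i => (Classical.arbitrary D, g i)).1 (h2 _)
  exact h3

/-- For the converse, an unsatisfiable `T` would force `⊤` to entail `⊥`, which a one-point
structure refutes. -/
theorem satisfiable_iff_isMostSpecificAnswer_top (hR : NoRigid R T) :
    Satisfiable T ↔ IsMostSpecificAnswer R T .top .top := by
  constructor
  · intro hT
    refine ⟨isAnswer_top, ?_, fun ψ hψ h => entails_top_of_isAnswer_top hR hT hψ h⟩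
    rintro D _ I - φ rfl g
    trivial
  · rintro ⟨-, -, h⟩
    by_contra hT
    have hbot : Entails T .bot := fun D hD I hI => (hT ⟨D, hD, I, hI⟩).elim
    let I : L.Structure PUnit.{max u v + 1} := ⟨fun _ _ => ⟨⟩, fun _ _ => True⟩
    refine h .bot isAnswer_bot hbot PUnit ⟨⟨⟩⟩ I ?_ .bot rfl fun _ => ⟨⟩
    rintro φ rfl g
    trivial

end Transfer

/-! ### Universal closures and clauses. -/

section Closure

variable {L : FirstOrder.Language.{u, v}}

namespace Formula

/-- Existential quantification over a list of variables. -/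
def exs (l : List ℕ) (φ : Formula L) : Formula L := l.foldr .ex φ

theorem freeVars_exs (l : List ℕ) (φ : Formula L) :
    (exs l φ).freeVars = φ.freeVars \ l.toFinset := by
  induction l with
  | nil => simp [exs]
  | cons x l ih =>
    change (exs l φ).freeVars.erase x = _
    rw [ih]
    ext y
    simp
    tauto

theorem funcs_exs (l : List ℕ) (φ : Formula L) : (exs l φ).funcs = φ.funcs := by
  induction l with
  | nil => rfl
  | cons x l ih => exact ih

/-- Once all assignments are considered, the updates made by the quantifiers add nothing new. -/
theorem forall_realize_exs {D : Type*} (I : L.Structure D) (l : List ℕ) (φ : Formula L) :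
    (∀ g, ¬ (exs l φ).Realize I g) ↔ ∀ g, ¬ φ.Realize I g := by
  induction l with
  | nil => rfl
  | cons x l ih =>
    rw [← ih]
    refine ⟨fun h g hg => h g ⟨g x, ?_⟩, fun h g hg => ?_⟩
    · rwa [Function.update_eq_self]
    · obtain ⟨d, hd⟩ := hg
      exact h _ hd

/-- The universal closure. -/
noncomputable def allClosure (φ : Formula L) : Formula L := neg (exs φ.freeVars.toList (neg φ))

theorem isSentence_allClosure (φ : Formula L) : φ.allClosure.IsSentence := by
  simp [IsSentence, allClosure, freeVars, freeVars_exs]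

theorem funcs_allClosure (φ : Formula L) : φ.allClosure.funcs = φ.funcs := by
  simp [allClosure, funcs, funcs_exs]

theorem forall_realize_allClosure {D : Type*} (I : L.Structure D) (φ : Formula L) :
    (∀ g, φ.allClosure.Realize I g) ↔ ∀ g, φ.Realize I g := by
  simp only [allClosure, Realize, forall_realize_exs, not_not]

/-- The clause with the premises `l` and the conclusion `ψ`. -/
def clause (l : List (Formula L)) (ψ : Formula L) : Formula L := neg (l.foldr and (neg ψ))

theorem realize_clause {D : Type*} (I : L.Structure D) (l : List (Formula L)) (ψ : Formula L)
    (g : ℕ → D) :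
    (clause l ψ).Realize I g ↔ ((∀ φ ∈ l, φ.Realize I g) → ψ.Realize I g) := by
  have : (l.foldr and (neg ψ)).Realize I g ↔
      (∀ φ ∈ l, φ.Realize I g) ∧ ¬ ψ.Realize I g := by
    induction l with
    | nil => simp [Realize]
    | cons φ l ih => simp [Realize, ih, and_assoc]
  simp only [clause, Realize, this]
  tauto

end Formula

end Closure

/-! ### Arithmetic and computation expressed by clauses with non-rigid function symbols. -/

section Arithmetic

open Nat.Partrec Encodable

/-- The constant zero. -/
def zeroTerm : fullLang.Term ℕ := .func (l := 0) (Sum.inr 0 : ℕ ⊕ ℕ) ![]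

/-- The successor of a term. -/
def succTerm (t : fullLang.Term ℕ) : fullLang.Term ℕ :=
  .func (l := 1) (Sum.inr 0 : ℕ ⊕ ℕ) ![t]

/-- The numeral for a natural number. -/
def numeral : ℕ → fullLang.Term ℕ
  | 0 => zeroTerm
  | n + 1 => succTerm (numeral n)

/-- The atom that says that `y` is the value of the code `c` at `x`. -/
def evalAtom (c : Code) (x y : fullLang.Term ℕ) : Formula fullLang :=
  .rel (n := 2) (encode c : ℕ) ![x, y]

/-- The atom that says that `z` codes the pair of `x` and `y`. -/
def pairAtom (x y z : fullLang.Term ℕ) : Formula fullLang := .rel (n := 3) (0 : ℕ) ![x, y, z]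

/-- The atom that says that `z` codes the pair of `x` and `y`, and `x + d + 1 = y`. -/
def ltAtom (x y d z : fullLang.Term ℕ) : Formula fullLang :=
  .rel (n := 4) (0 : ℕ) ![x, y, d, z]

/-- The atom that says that `z` codes the pair of `x` and `y`, and `y + d = x`. -/
def geAtom (x y d z : fullLang.Term ℕ) : Formula fullLang :=
  .rel (n := 4) (1 : ℕ) ![x, y, d, z]

section Realize

variable {D : Type*} (I : fullLang.Structure D)

/-- The interpretation of zero. -/
def zeroOf : D := I.funMap (n := 0) (Sum.inr 0 : ℕ ⊕ ℕ) ![]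

/-- The interpretation of the successor. -/
def succOf (x : D) : D := I.funMap (n := 1) (Sum.inr 0 : ℕ ⊕ ℕ) ![x]

/-- The interpretation of numerals. -/
def numOf : ℕ → D
  | 0 => zeroOf I
  | n + 1 => succOf I (numOf n)

/-- The interpretation of `evalAtom`. -/
def EvalOf (c : Code) (x y : D) : Prop := I.RelMap (n := 2) (encode c : ℕ) ![x, y]

/-- The interpretation of `pairAtom`. -/
def PairOf (x y z : D) : Prop := I.RelMap (n := 3) (0 : ℕ) ![x, y, z]

/-- The interpretation of `ltAtom`. -/
def LtOf (x y d z : D) : Prop := I.RelMap (n := 4) (0 : ℕ) ![x, y, d, z]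

/-- The interpretation of `geAtom`. -/
def GeOf (x y d z : D) : Prop := I.RelMap (n := 4) (1 : ℕ) ![x, y, d, z]

variable (g : ℕ → D)

theorem realize_var (x : ℕ) :
    (FirstOrder.Language.Term.var x : fullLang.Term ℕ).realize g = g x := rfl

theorem realize_zeroTerm : zeroTerm.realize g = zeroOf I := by
  simp only [zeroTerm, zeroOf, FirstOrder.Language.Term.realize]
  congr 1
  exact Subsingleton.elim _ _

theorem realize_succTerm (t : fullLang.Term ℕ) :
    (succTerm t).realize g = succOf I (t.realize g) := by
  simp only [succTerm, succOf, FirstOrder.Language.Term.realize]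
  congr 1
  funext i
  fin_cases i
  rfl

theorem realize_numeral (n : ℕ) : (numeral n).realize g = numOf I n := by
  induction n with
  | zero => exact realize_zeroTerm I g
  | succ n ih => rw [numeral, realize_succTerm, ih, numOf]

theorem realize_evalAtom (c : Code) (x y : fullLang.Term ℕ) :
    (evalAtom c x y).Realize I g ↔ EvalOf I c (x.realize g) (y.realize g) := by
  simp only [evalAtom, EvalOf, Formula.Realize]
  refine iff_of_eq (congrArg _ (funext fun i => ?_))
  fin_cases i <;> rfl

theorem realize_pairAtom (x y z : fullLang.Term ℕ) :
    (pairAtom x y z).Realize I g ↔ PairOf I (x.realize g) (y.realize g) (z.realize g) := by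
  simp only [pairAtom, PairOf, Formula.Realize]
  refine iff_of_eq (congrArg _ (funext fun i => ?_))
  fin_cases i <;> rfl

theorem realize_ltAtom (x y d z : fullLang.Term ℕ) :
    (ltAtom x y d z).Realize I g ↔
      LtOf I (x.realize g) (y.realize g) (d.realize g) (z.realize g) := by
  simp only [ltAtom, LtOf, Formula.Realize]
  refine iff_of_eq (congrArg _ (funext fun i => ?_))
  fin_cases i <;> rfl

theorem realize_geAtom (x y d z : fullLang.Term ℕ) :
    (geAtom x y d z).Realize I g ↔
      GeOf I (x.realize g) (y.realize g) (d.realize g) (z.realize g) := by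
  simp only [geAtom, GeOf, Formula.Realize]
  refine iff_of_eq (congrArg _ (funext fun i => ?_))
  fin_cases i <;> rfl

end Realize

section NonRigid

/-- No rigid function symbol occurs in the term. -/
def NonRigidTerm (t : fullLang.Term ℕ) : Prop := Disjoint (termFuncs t) fullRigid

/-- No rigid function symbol occurs in the formula. -/
def NonRigidFormula (φ : Formula fullLang) : Prop := Disjoint φ.funcs fullRigid

theorem nonRigidTerm_var (x : ℕ) : NonRigidTerm (.var x) := by
  simp [NonRigidTerm, termFuncs]

theorem nonRigidTerm_zeroTerm : NonRigidTerm zeroTerm := by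
  simp [NonRigidTerm, termFuncs, zeroTerm, fullRigid]

theorem nonRigidTerm_succTerm {t : fullLang.Term ℕ} :
    NonRigidTerm (succTerm t) ↔ NonRigidTerm t := by
  simp [NonRigidTerm, termFuncs, succTerm, fullRigid]

theorem nonRigidTerm_numeral (n : ℕ) : NonRigidTerm (numeral n) := by
  induction n with
  | zero => exact nonRigidTerm_zeroTerm
  | succ n ih => exact nonRigidTerm_succTerm.2 ih

theorem nonRigidFormula_rel {n : ℕ} {P : fullLang.Relations n}
    {ts : Fin n → fullLang.Term ℕ} :
    NonRigidFormula (.rel P ts) ↔ ∀ i, NonRigidTerm (ts i) := by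
  simp only [NonRigidFormula, Formula.funcs, NonRigidTerm, Set.disjoint_iUnion_left]

theorem nonRigidFormula_evalAtom {c : Code} {x y : fullLang.Term ℕ} :
    NonRigidFormula (evalAtom c x y) ↔ NonRigidTerm x ∧ NonRigidTerm y := by
  simp [evalAtom, nonRigidFormula_rel, Fin.forall_fin_succ]

theorem nonRigidFormula_pairAtom {x y z : fullLang.Term ℕ} :
    NonRigidFormula (pairAtom x y z) ↔
      NonRigidTerm x ∧ NonRigidTerm y ∧ NonRigidTerm z := by
  simp [pairAtom, nonRigidFormula_rel, Fin.forall_fin_succ]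

theorem nonRigidFormula_ltAtom {x y d z : fullLang.Term ℕ} :
    NonRigidFormula (ltAtom x y d z) ↔
      NonRigidTerm x ∧ NonRigidTerm y ∧ NonRigidTerm d ∧ NonRigidTerm z := by
  simp [ltAtom, nonRigidFormula_rel, Fin.forall_fin_succ]

theorem nonRigidFormula_geAtom {x y d z : fullLang.Term ℕ} :
    NonRigidFormula (geAtom x y d z) ↔
      NonRigidTerm x ∧ NonRigidTerm y ∧ NonRigidTerm d ∧ NonRigidTerm z := by
  simp [geAtom, nonRigidFormula_rel, Fin.forall_fin_succ]

theorem nonRigidFormula_clause (l : List (Formula fullLang)) (ψ : Formula fullLang) :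
    NonRigidFormula (.clause l ψ) ↔ (∀ φ ∈ l, NonRigidFormula φ) ∧ NonRigidFormula ψ := by
  change NonRigidFormula (l.foldr .and (.neg ψ)) ↔ _
  induction l with
  | nil =>
    change NonRigidFormula ψ ↔ _
    simp
  | cons φ l ih =>
    have : NonRigidFormula (.and φ (l.foldr .and (.neg ψ))) ↔
        NonRigidFormula φ ∧ NonRigidFormula (l.foldr .and (.neg ψ)) := Set.disjoint_union_left
    rw [List.foldr_cons, this, ih, List.forall_mem_cons, and_assoc]

end NonRigid

/-! ### The theory of a computation. -/

section Axioms

open FirstOrder.Language.Term (var)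
open Formula (clause)

/-- Clauses that enumerate the pairs of natural numbers in the order of `Nat.pair`. -/
def pairClauses : List (Formula fullLang) :=
  -- Shell `k` of `Nat.pair` is the row (0,k), …, (k-1,k), followed by the row (k,0), …, (k,k). The
  -- predicates of `ltAtom` and `geAtom` mark these two kinds of row, and their third argument
  -- counts the steps left in the row; at zero the walk passes to the next row. No axioms for
  -- addition, multiplication or order are needed.
  [clause [] (geAtom zeroTerm zeroTerm zeroTerm zeroTerm),
   clause [geAtom (var 0) (var 1) (succTerm (var 2)) (var 3)]
     (geAtom (var 0) (succTerm (var 1)) (var 2) (succTerm (var 3))),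
   clause [geAtom (var 0) (var 1) zeroTerm (var 3)]
     (ltAtom zeroTerm (succTerm (var 0)) (var 0) (succTerm (var 3))),
   clause [ltAtom (var 0) (var 1) (succTerm (var 2)) (var 3)]
     (ltAtom (succTerm (var 0)) (var 1) (var 2) (succTerm (var 3))),
   clause [ltAtom (var 0) (var 1) zeroTerm (var 3)]
     (geAtom (var 1) zeroTerm (var 1) (succTerm (var 3))),
   clause [geAtom (var 0) (var 1) (var 2) (var 3)] (pairAtom (var 0) (var 1) (var 3)),
   clause [ltAtom (var 0) (var 1) (var 2) (var 3)] (pairAtom (var 0) (var 1) (var 3))]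

/-- Clauses that describe the graph of a code in terms of the graphs of its immediate subcodes. -/
def stepClauses : Code → List (Formula fullLang)
  | .zero => [clause [] (evalAtom .zero (var 0) zeroTerm)]
  | .succ => [clause [] (evalAtom .succ (var 0) (succTerm (var 0)))]
  | .left => [clause [pairAtom (var 0) (var 1) (var 2)] (evalAtom .left (var 2) (var 0))]
  | .right => [clause [pairAtom (var 0) (var 1) (var 2)] (evalAtom .right (var 2) (var 1))]
  | .pair a b =>
      [clause [evalAtom a (var 0) (var 1), evalAtom b (var 0) (var 2),
        pairAtom (var 1) (var 2) (var 3)] (evalAtom (.pair a b) (var 0) (var 3))]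
  | .comp a b =>
      [clause [evalAtom b (var 0) (var 1), evalAtom a (var 1) (var 2)]
        (evalAtom (.comp a b) (var 0) (var 2))]
  | .prec a b =>
      [clause [pairAtom (var 0) zeroTerm (var 1), evalAtom a (var 0) (var 2)]
        (evalAtom (.prec a b) (var 1) (var 2)),
       clause [pairAtom (var 0) (var 1) (var 2), evalAtom (.prec a b) (var 2) (var 3),
          pairAtom (var 1) (var 3) (var 4), pairAtom (var 0) (var 4) (var 5),
          evalAtom b (var 5) (var 6), pairAtom (var 0) (succTerm (var 1)) (var 7)]
        (evalAtom (.prec a b) (var 7) (var 6))]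
  | .rfind' a =>
      -- The second component of the input is where the search starts: the value zero ends the
      -- search there, and a successor moves the start up by one.
      [clause [pairAtom (var 0) (var 1) (var 2), evalAtom a (var 2) zeroTerm]
        (evalAtom (.rfind' a) (var 2) (var 1)),
       clause [pairAtom (var 0) (var 1) (var 2), evalAtom a (var 2) (succTerm (var 3)),
          pairAtom (var 0) (succTerm (var 1)) (var 4), evalAtom (.rfind' a) (var 4) (var 5)]
        (evalAtom (.rfind' a) (var 2) (var 5))]

/-- Clauses that describe the graphs of a code and of all its subcodes. -/
def codeClauses : Code → List (Formula fullLang)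
  | .zero => stepClauses .zero
  | .succ => stepClauses .succ
  | .left => stepClauses .left
  | .right => stepClauses .right
  | .pair a b => stepClauses (.pair a b) ++ codeClauses a ++ codeClauses b
  | .comp a b => stepClauses (.comp a b) ++ codeClauses a ++ codeClauses b
  | .prec a b => stepClauses (.prec a b) ++ codeClauses a ++ codeClauses b
  | .rfind' a => stepClauses (.rfind' a) ++ codeClauses a

/-- Reduces a property of all clauses to a check for each code constructor; serves both non-rigidity
and truth in the standard structure. -/
theorem forall_mem_codeClauses {p : Formula fullLang → Prop}
    (h : ∀ c, ∀ φ ∈ stepClauses c, p φ) (c : Code) : ∀ φ ∈ codeClauses c, p φ := by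
  induction c with
  | zero | succ | left | right => exact h _
  | pair a b iha ihb | comp a b iha ihb | prec a b iha ihb =>
    simp only [codeClauses, List.mem_append]
    rintro φ ((hφ | hφ) | hφ)
    exacts [h _ _ hφ, iha _ hφ, ihb _ hφ]
  | rfind' a iha =>
    simp only [codeClauses, List.mem_append]
    rintro φ (hφ | hφ)
    exacts [h _ _ hφ, iha _ hφ]

theorem nonRigidFormula_pairClauses : ∀ φ ∈ pairClauses, NonRigidFormula φ := by
  simp [pairClauses, nonRigidFormula_clause, nonRigidFormula_geAtom, nonRigidFormula_ltAtom,
    nonRigidFormula_pairAtom, nonRigidTerm_var, nonRigidTerm_zeroTerm, nonRigidTerm_succTerm]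

theorem nonRigidFormula_codeClauses (c : Code) : ∀ φ ∈ codeClauses c, NonRigidFormula φ := by
  refine forall_mem_codeClauses (fun c => ?_) c
  cases c <;>
  simp [stepClauses, nonRigidFormula_clause, nonRigidFormula_evalAtom, nonRigidFormula_pairAtom,
    nonRigidTerm_var, nonRigidTerm_zeroTerm, nonRigidTerm_succTerm]

/-- The sentence that says that the code `c` has no value at `n`. -/
def divergenceSentence (c : Code) (n : ℕ) : Formula fullLang :=
  .neg (.ex 0 (evalAtom c (numeral n) (var 0)))

/-- A finite theory that is satisfiable if and only if the code `c` has no value at `n`. -/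
noncomputable def divergenceTheory (c : Code) (n : ℕ) : List (Formula fullLang) :=
  divergenceSentence c n :: (pairClauses ++ codeClauses c).map Formula.allClosure

theorem varFinset_numeral (n : ℕ) : (numeral n).varFinset = ∅ := by
  induction n with
  | zero => rfl
  | succ n ih => simp [numeral, succTerm, FirstOrder.Language.Term.varFinset, ih]

theorem isTheory_divergenceTheory (c : Code) (n : ℕ) :
    IsTheory {σ | σ ∈ divergenceTheory c n} := by
  intro σ hσ
  rcases List.mem_cons.1 hσ with rfl | hσ
  · ext x
    simp [divergenceSentence, evalAtom, Formula.freeVars, Fin.exists_fin_two, varFinset_numeral,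
      FirstOrder.Language.Term.varFinset]
  · obtain ⟨φ, -, rfl⟩ := List.mem_map.1 hσ
    exact φ.isSentence_allClosure

theorem noRigid_divergenceTheory (c : Code) (n : ℕ) :
    NoRigid fullRigid {σ | σ ∈ divergenceTheory c n} := by
  intro σ hσ
  rcases List.mem_cons.1 hσ with rfl | hσ
  · exact (nonRigidFormula_evalAtom (c := c)).2 ⟨nonRigidTerm_numeral n, nonRigidTerm_var 0⟩
  · obtain ⟨φ, hφ, rfl⟩ := List.mem_map.1 hσ
    rw [Formula.funcs_allClosure]
    rcases List.mem_append.1 hφ with hφ | hφ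
    · exact nonRigidFormula_pairClauses φ hφ
    · exact nonRigidFormula_codeClauses c φ hφ

end Axioms

/-- Here `j` is the length of the search, while the value is the absolute position `j + m`. Nonzero
values appear as `r + 1` to match the successor term in the clauses. -/
theorem mem_eval_rfind' {a : Code} {x m k : ℕ} :
    k ∈ (Code.rfind' a).eval (Nat.pair x m) ↔ ∃ j, 0 ∈ a.eval (Nat.pair x (j + m)) ∧
      (∀ i < j, ∃ r, r + 1 ∈ a.eval (Nat.pair x (i + m))) ∧ j + m = k := by
  simp only [Code.eval, Nat.unpaired, Nat.unpair_pair, Part.mem_map_iff]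
  refine exists_congr fun j =>
    (and_congr_left' (Nat.mem_rfind.trans (and_congr ?_ ?_))).trans and_assoc
  · refine (Part.mem_map_iff _).trans ⟨?_, fun h => ⟨0, h, rfl⟩⟩
    rintro ⟨r, hr, h⟩
    rwa [of_decide_eq_true h] at hr
  · refine ⟨fun h i hi => ?_, fun h i hi => ?_⟩
    · obtain ⟨r, hr, h⟩ := (Part.mem_map_iff _).1 (h hi)
      obtain ⟨s, rfl⟩ := Nat.exists_eq_succ_of_ne_zero (of_decide_eq_false h)
      exact ⟨s, hr⟩
    · obtain ⟨r, hr⟩ := h i hi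
      exact (Part.mem_map_iff _).2 ⟨r + 1, hr, rfl⟩

/-! ### True computations hold in every model of the clauses. -/

section Derivation

variable {D : Type*} (I : fullLang.Structure D)

/-- All universal closures of the formulas in a list hold. -/
def Valid (l : List (Formula fullLang)) : Prop := ∀ φ ∈ l, ∀ g : ℕ → D, φ.Realize I g

theorem valid_append {l m : List (Formula fullLang)} :
    Valid I (l ++ m) ↔ Valid I l ∧ Valid I m := by
  simp only [Valid, List.mem_append, or_imp, forall_and]

variable {I}

/-- The pair clauses prove that every number is the code of its pair. -/
theorem pairOf_of_valid (h : Valid I pairClauses) (a b : ℕ) :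
    PairOf I (numOf I a) (numOf I b) (numOf I (Nat.pair a b)) := by
  simp only [Valid, pairClauses, List.forall_mem_cons, Formula.realize_clause, List.not_mem_nil,
    IsEmpty.forall_iff, implies_true, and_true, forall_const, realize_geAtom, realize_ltAtom,
    realize_pairAtom, realize_succTerm, realize_zeroTerm, realize_var] at h
  obtain ⟨h0, h1, h2, h3, h4, h5, h6⟩ := h
  have ge_row : ∀ k z, GeOf I (numOf I k) (numOf I 0) (numOf I k) (numOf I z) →
      ∀ j d, j + d = k → GeOf I (numOf I k) (numOf I j) (numOf I d) (numOf I (z + j)) := by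
    intro k z hz j
    induction j with
    | zero =>
      intro d hd
      obtain rfl : d = k := by omega
      exact hz
    | succ j ih =>
      intro d hd
      -- Assignments are given as lists: entry `i` is the value of variable `i`, and the default
      -- serves all later variables, here variable 3.
      exact h1 (fun i => [numOf I k, numOf I j, numOf I d].getD i (numOf I (z + j)))
        (ih (d + 1) (by omega))
  have lt_row : ∀ k m z, LtOf I (numOf I 0) (numOf I k) (numOf I m) (numOf I z) →
      ∀ j d, j + d = m → LtOf I (numOf I j) (numOf I k) (numOf I d) (numOf I (z + j)) := by
    intro k m z hz j
    induction j with
    | zero =>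
      intro d hd
      obtain rfl : d = m := by omega
      exact hz
    | succ j ih =>
      intro d hd
      exact h3 (fun i => [numOf I j, numOf I k, numOf I d].getD i (numOf I (z + j)))
        (ih (d + 1) (by omega))
  -- Shell `k` ends at (k,k) with code `k * k + k + k`; the next code, `(k + 1) * (k + 1)`, belongs
  -- to (0,k+1).
  have lt_start : ∀ k, GeOf I (numOf I k) (numOf I 0) (numOf I k) (numOf I (k * k + k)) →
      LtOf I (numOf I 0) (numOf I (k + 1)) (numOf I k) (numOf I ((k + 1) * (k + 1))) := by
    intro k hk
    have := h2 (fun i => [numOf I k, numOf I k, numOf I 0].getD i (numOf I (k * k + k + k)))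
      (ge_row k _ hk k 0 rfl)
    rw [show (k + 1) * (k + 1) = k * k + k + k + 1 by ring]
    exact this
  have ge_start : ∀ k, GeOf I (numOf I k) (numOf I 0) (numOf I k) (numOf I (k * k + k)) := by
    intro k
    induction k with
    | zero => exact h0 fun _ => zeroOf I
    | succ k ih =>
      exact h4 (fun i => [numOf I k, numOf I (k + 1), numOf I 0].getD i
        (numOf I ((k + 1) * (k + 1) + k))) (lt_row _ _ _ (lt_start k ih) k 0 rfl)
  rw [Nat.pair]
  split_ifs with hab
  · obtain ⟨d, rfl⟩ := Nat.exists_eq_add_of_lt hab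
    exact h6 (fun i => [numOf I a, numOf I (a + d + 1), numOf I d].getD i
      (numOf I ((a + d + 1) * (a + d + 1) + a)))
      (lt_row _ _ _ (lt_start _ (ge_start _)) a d rfl)
  · obtain ⟨d, rfl⟩ := Nat.exists_eq_add_of_le (not_lt.1 hab)
    exact h5 (fun i => [numOf I (b + d), numOf I b, numOf I d].getD i
      (numOf I ((b + d) * (b + d) + (b + d) + b)))
      (ge_row _ _ (ge_start _) b d rfl)

/-- The clauses for a code prove every true statement about its graph. -/
theorem evalOf_of_valid (hp : Valid I pairClauses) (c : Code) (hc : Valid I (codeClauses c)) :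
    ∀ n k, k ∈ c.eval n → EvalOf I c (numOf I n) (numOf I k) := by
  have pair := pairOf_of_valid hp
  have unpair : ∀ n : ℕ, PairOf I (numOf I n.unpair.1) (numOf I n.unpair.2) (numOf I n) :=
    fun n => by simpa using pair n.unpair.1 n.unpair.2
  induction c with
  | zero =>
    intro n k hk
    simp only [Valid, codeClauses, stepClauses, List.forall_mem_cons, Formula.realize_clause,
      List.not_mem_nil, IsEmpty.forall_iff, implies_true, and_true, forall_const,
      realize_evalAtom, realize_zeroTerm, realize_var] at hc
    obtain rfl : k = 0 := by simpa [Code.eval, pure, PFun.pure] using hk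
    exact hc fun _ => numOf I n
  | succ =>
    intro n k hk
    simp only [Valid, codeClauses, stepClauses, List.forall_mem_cons, Formula.realize_clause,
      List.not_mem_nil, IsEmpty.forall_iff, implies_true, and_true, forall_const,
      realize_evalAtom, realize_succTerm, realize_var] at hc
    obtain rfl : k = n + 1 := by simpa [Code.eval] using hk
    exact hc fun _ => numOf I n
  | left =>
    intro n k hk
    simp only [Valid, codeClauses, stepClauses, List.forall_mem_cons, Formula.realize_clause,
      List.not_mem_nil, IsEmpty.forall_iff, implies_true, and_true,
      realize_evalAtom, realize_pairAtom, realize_var] at hc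
    obtain rfl : k = n.unpair.1 := by simpa [Code.eval] using hk
    exact hc (fun i => [numOf I n.unpair.1, numOf I n.unpair.2].getD i (numOf I n)) (unpair n)
  | right =>
    intro n k hk
    simp only [Valid, codeClauses, stepClauses, List.forall_mem_cons, Formula.realize_clause,
      List.not_mem_nil, IsEmpty.forall_iff, implies_true, and_true,
      realize_evalAtom, realize_pairAtom, realize_var] at hc
    obtain rfl : k = n.unpair.2 := by simpa [Code.eval] using hk
    exact hc (fun i => [numOf I n.unpair.1, numOf I n.unpair.2].getD i (numOf I n)) (unpair n)
  | pair a b iha ihb =>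
    intro n k hk
    rw [codeClauses, valid_append, valid_append] at hc
    obtain ⟨⟨hc, ha⟩, hb⟩ := hc
    simp only [Valid, stepClauses, List.forall_mem_cons, Formula.realize_clause,
      List.not_mem_nil, IsEmpty.forall_iff, implies_true, and_true,
      realize_evalAtom, realize_pairAtom, realize_var] at hc
    obtain ⟨x, hx, y, hy, rfl⟩ : ∃ x ∈ a.eval n, ∃ y ∈ b.eval n, Nat.pair x y = k := by
      simpa [Code.eval, Seq.seq] using hk
    exact hc (fun i => [numOf I n, numOf I x, numOf I y].getD i (numOf I (Nat.pair x y)))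
      ⟨iha ha _ _ hx, ihb hb _ _ hy, pair x y⟩
  | comp a b iha ihb =>
    intro n k hk
    rw [codeClauses, valid_append, valid_append] at hc
    obtain ⟨⟨hc, ha⟩, hb⟩ := hc
    simp only [Valid, stepClauses, List.forall_mem_cons, Formula.realize_clause,
      List.not_mem_nil, IsEmpty.forall_iff, implies_true, and_true,
      realize_evalAtom, realize_var] at hc
    obtain ⟨x, hx, hk⟩ := Part.mem_bind_iff.1 hk
    exact hc (fun i => [numOf I n, numOf I x].getD i (numOf I k))
      ⟨ihb hb _ _ hx, iha ha _ _ hk⟩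
  | prec a b iha ihb =>
    rw [codeClauses, valid_append, valid_append] at hc
    obtain ⟨⟨hc, ha⟩, hb⟩ := hc
    simp only [Valid, stepClauses, List.forall_mem_cons, Formula.realize_clause,
      List.not_mem_nil, IsEmpty.forall_iff, implies_true, and_true,
      realize_evalAtom, realize_pairAtom, realize_succTerm, realize_zeroTerm, realize_var] at hc
    -- Induction on the recursion argument `m`; the pair codes are explicit witnesses because the
    -- language has a pairing predicate, not a pairing function.
    have key : ∀ m x k, k ∈ (Code.prec a b).eval (Nat.pair x m) →
        EvalOf I (.prec a b) (numOf I (Nat.pair x m)) (numOf I k) := by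
      intro m x
      induction m with
      | zero =>
        intro k hk
        rw [Code.eval_prec_zero] at hk
        exact hc.1 (fun i => [numOf I x, numOf I (Nat.pair x 0)].getD i (numOf I k))
          ⟨pair x 0, iha ha _ _ hk⟩
      | succ m ih =>
        intro k hk
        rw [Code.eval_prec_succ] at hk
        obtain ⟨r, hr, hk⟩ := Part.mem_bind_iff.1 hk
        exact hc.2 (fun i => [numOf I x, numOf I m, numOf I (Nat.pair x m), numOf I r,
            numOf I (Nat.pair m r), numOf I (Nat.pair x (Nat.pair m r)), numOf I k].getD i
              (numOf I (Nat.pair x (m + 1))))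
          ⟨pair x m, ih _ hr, pair m r, pair _ _, ihb hb _ _ hk, pair x (m + 1)⟩
    intro n k hk
    simpa using key n.unpair.2 n.unpair.1 k (by simpa using hk)
  | rfind' a iha =>
    rw [codeClauses, valid_append] at hc
    obtain ⟨hc, ha⟩ := hc
    simp only [Valid, stepClauses, List.forall_mem_cons, Formula.realize_clause,
      List.not_mem_nil, IsEmpty.forall_iff, implies_true, and_true,
      realize_evalAtom, realize_pairAtom, realize_succTerm, realize_zeroTerm, realize_var] at hc
    -- Induction on the length `j` of the search, with `m` left general because the recursive clause
    -- restarts it at `m + 1`.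
    have key : ∀ j x m, 0 ∈ a.eval (Nat.pair x (j + m)) →
        (∀ i < j, ∃ r, r + 1 ∈ a.eval (Nat.pair x (i + m))) →
        EvalOf I (.rfind' a) (numOf I (Nat.pair x m)) (numOf I (j + m)) := by
      intro j x
      induction j with
      | zero =>
        intro m h0 _
        rw [Nat.zero_add] at h0 ⊢
        exact hc.1 (fun i => [numOf I x, numOf I m].getD i (numOf I (Nat.pair x m)))
          ⟨pair x m, iha ha _ _ h0⟩
      | succ j ih =>
        intro m h0 hs
        obtain ⟨r, hr⟩ := hs 0 j.succ_pos
        rw [Nat.zero_add] at hr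
        rw [show j + 1 + m = j + (m + 1) by omega] at h0 ⊢
        refine hc.2 (fun i => [numOf I x, numOf I m, numOf I (Nat.pair x m), numOf I r,
          numOf I (Nat.pair x (m + 1))].getD i (numOf I (j + (m + 1))))
          ⟨pair x m, iha ha _ _ hr, pair x (m + 1), ih (m + 1) h0 fun i hi => ?_⟩
        obtain ⟨r, hr⟩ := hs (i + 1) (by omega)
        exact ⟨r, by rwa [show i + (m + 1) = i + 1 + m by omega]⟩
    intro n k hk
    rw [← Nat.pair_unpair n, mem_eval_rfind'] at hk
    obtain ⟨j, h0, hs, rfl⟩ := hk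
    simpa using key j n.unpair.1 n.unpair.2 h0 hs

end Derivation

/-! ### The standard model of the clauses. -/

section Standard

open Denumerable

/-- The natural numbers with the intended interpretation of the clauses. -/
@[reducible] def standardStructure : fullLang.Structure ℕ where
  funMap := fun {n} _ v =>
    match n, v with
    | 0, _ => 0
    | _ + 1, v => v 0 + 1
  RelMap := fun {n} (P : ℕ) v =>
    match n, v with
    -- The predicate symbol is itself a Gödel number, so one structure interprets the graphs of all
    -- codes at once.
    | 2, v => v 1 ∈ (ofNat Code P).eval (v 0)
    | 3, v => Nat.pair (v 0) (v 1) = v 2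
    | 4, v => Nat.pair (v 0) (v 1) = v 3 ∧ if P = 0 then v 0 + v 2 + 1 = v 1 else v 1 + v 2 = v 0
    | _, _ => False

theorem zeroOf_standardStructure : zeroOf standardStructure = 0 := rfl

theorem succOf_standardStructure (x : ℕ) : succOf standardStructure x = x + 1 := rfl

theorem numOf_standardStructure (n : ℕ) : numOf standardStructure n = n := by
  induction n with
  | zero => rfl
  | succ n ih => rw [numOf, succOf_standardStructure, ih]

theorem evalOf_standardStructure (c : Code) (x y : ℕ) :
    EvalOf standardStructure c x y ↔ y ∈ c.eval x := by
  change y ∈ (ofNat Code (encode c)).eval x ↔ _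
  rw [ofNat_encode]

theorem pairOf_standardStructure (x y z : ℕ) :
    PairOf standardStructure x y z ↔ Nat.pair x y = z := Iff.rfl

theorem ltOf_standardStructure (x y d z : ℕ) :
    LtOf standardStructure x y d z ↔ Nat.pair x y = z ∧ x + d + 1 = y := Iff.rfl

theorem geOf_standardStructure (x y d z : ℕ) :
    GeOf standardStructure x y d z ↔ Nat.pair x y = z ∧ y + d = x := Iff.rfl

/-- Each step of the walk raises the value of `Nat.pair` by exactly one, as its closed form shows.
-/
theorem valid_pairClauses_standardStructure : Valid standardStructure pairClauses := by
  simp only [Valid, pairClauses, List.forall_mem_cons, Formula.realize_clause, List.not_mem_nil,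
    IsEmpty.forall_iff, implies_true, and_true, forall_const, realize_geAtom, realize_ltAtom,
    realize_pairAtom, realize_succTerm, realize_zeroTerm, realize_var, zeroOf_standardStructure,
    succOf_standardStructure, ltOf_standardStructure, geOf_standardStructure,
    pairOf_standardStructure]
  refine ⟨rfl, fun g h => ⟨?_, by omega⟩, fun g h => ⟨?_, by omega⟩, fun g h => ⟨?_, by omega⟩,
    fun g h => ⟨?_, by omega⟩, fun g h => h.1, fun g h => h.1⟩
  · rw [← h.1, Nat.pair, Nat.pair, if_neg (by omega), if_neg (by omega)]
    ring
  · obtain ⟨h, hb⟩ := h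
    rw [Nat.add_zero] at hb
    rw [← h, hb, Nat.pair, Nat.pair, if_pos (by omega), if_neg (by omega)]
    ring
  · rw [← h.1, Nat.pair, Nat.pair, if_pos (by omega), if_pos (by omega)]
    ring
  · obtain ⟨h, hb⟩ := h
    rw [← h, ← hb, Nat.pair, Nat.pair, if_neg (by omega), if_pos (by omega)]
    ring

/-- The clauses only assert that graphs are closed under the evaluation rules, so undefined values
do no harm. -/
theorem valid_stepClauses_standardStructure (c : Code) :
    Valid standardStructure (stepClauses c) := by
  cases c <;>
  simp only [Valid, stepClauses, List.forall_mem_cons, Formula.realize_clause,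
    List.not_mem_nil, IsEmpty.forall_iff, implies_true, and_true, forall_const,
    realize_pairAtom, realize_evalAtom, realize_succTerm, realize_zeroTerm, realize_var,
    zeroOf_standardStructure, succOf_standardStructure, evalOf_standardStructure,
    pairOf_standardStructure]
  case zero => simp [Code.eval, pure, PFun.pure]
  case succ => simp [Code.eval]
  case left =>
    intro g h
    simp [Code.eval, ← h]
  case right =>
    intro g h
    simp [Code.eval, ← h]
  case pair a b =>
    rintro g ⟨ha, hb, h⟩
    simpa [Code.eval, Seq.seq] using ⟨_, ha, _, hb, h⟩
  case comp a b =>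
    rintro g ⟨hb, ha⟩
    exact Part.mem_bind hb ha
  case prec a b =>
    refine ⟨?_, ?_⟩
    · rintro g ⟨h, ha⟩
      rwa [← h, Code.eval_prec_zero]
    · rintro g ⟨h2, h3, h4, h5, h6, h7⟩
      rw [← h7, Code.eval_prec_succ]
      rw [← h2] at h3
      rw [← h5, ← h4] at h6
      exact Part.mem_bind h3 h6
  case rfind' a =>
    refine ⟨?_, ?_⟩
    · rintro g ⟨h2, h0⟩
      rw [← h2] at h0 ⊢
      exact mem_eval_rfind'.2 ⟨0, by rwa [Nat.zero_add], by simp, Nat.zero_add _⟩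
    · rintro g ⟨h2, h3, h4, h5⟩
      rw [← h2] at h3 ⊢
      rw [← h4] at h5
      obtain ⟨j, h0, hs, hj⟩ := mem_eval_rfind'.1 h5
      refine mem_eval_rfind'.2 ⟨j + 1, ?_, ?_, ?_⟩
      · rwa [show j + 1 + g 1 = j + (g 1 + 1) by omega]
      · rintro (_ | i) hi
        · exact ⟨g 3, by rwa [Nat.zero_add]⟩
        · rw [show i + 1 + g 1 = i + (g 1 + 1) by omega]
          exact hs i (by omega)
      · omega

end Standard

/-! ### Reduction from the halting problem. -/

section Undecidability

/-- If `c` halts at `n`, every model of the clauses contains the value as a numeral, against the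
divergence sentence; nonstandard elements are irrelevant. If it diverges, the standard structure is
a model. -/
theorem satisfiable_divergenceTheory (c : Code) (n : ℕ) :
    Satisfiable {σ | σ ∈ divergenceTheory c n} ↔ ¬ (c.eval n).Dom := by
  have hquery : ∀ {D : Type} (I : fullLang.Structure D) (g : ℕ → D),
      (divergenceSentence c n).Realize I g ↔ ∀ d, ¬ EvalOf I c (numOf I n) d := by
    intro D I g
    simp only [divergenceSentence, Formula.Realize, realize_evalAtom, realize_numeral,
      realize_var, Function.update_self, not_exists]
  have hmodel : ∀ {D : Type} [Nonempty D] (I : fullLang.Structure D),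
      IsModel I {σ | σ ∈ divergenceTheory c n} ↔
        (∀ d, ¬ EvalOf I c (numOf I n) d) ∧ Valid I (pairClauses ++ codeClauses c) := by
    intro D _ I
    simp only [IsModel, divergenceTheory, Set.mem_ofPred_eq, List.forall_mem_cons,
      List.forall_mem_map, Formula.forall_realize_allClosure, hquery, forall_const, Valid]
  constructor
  · rintro ⟨D, _, I, hI⟩ hn
    obtain ⟨k, hk⟩ := Part.dom_iff_mem.1 hn
    obtain ⟨hq, hv⟩ := (hmodel I).1 hI
    rw [valid_append] at hv
    exact hq _ (evalOf_of_valid hv.1 c hv.2 n k hk)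
  · intro hn
    refine ⟨ℕ, inferInstance, standardStructure, (hmodel _).2 ⟨fun d hd => hn ?_, ?_⟩⟩
    · rw [evalOf_standardStructure, numOf_standardStructure] at hd
      exact Part.dom_iff_mem.2 ⟨d, hd⟩
    · exact (valid_append _).2 ⟨valid_pairClauses_standardStructure,
        forall_mem_codeClauses valid_stepClauses_standardStructure c⟩

theorem primrec_encodeTerm_numeral : Primrec fun n => encodeTerm (numeral n) := by
  have h : Primrec fun n : ℕ =>
      Nat.rec (motive := fun _ => ℕ) (encodeTerm zeroTerm) (fun _ t =>
        2 * Nat.pair (encode (α := ℕ ⊕ ℕ) (Sum.inr 0)) (encode [t]) + 1) n := by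
    refine Primrec.nat_rec₁ _ (Primrec.succ.comp (Primrec.nat_mul.comp (Primrec.const 2)
      (Primrec₂.natPair.comp (Primrec.const _) (Primrec.encode.comp
        (Primrec.list_cons.comp Primrec.snd (Primrec.const []))))))
  refine h.of_eq fun n => ?_
  induction n with
  | zero => rfl
  | succ n ih =>
    simp only [ih]
    rfl

theorem primrec_divergenceSentence (c : Code) : Primrec (divergenceSentence c) := by
  have h : Primrec fun n : ℕ =>
      -- The Gödel number unfolded: 3 marks the negation, 5 the quantifier (with bound variable 0),
      -- 2 the predication; the final 0 in the list codes the term `var 0`.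
      4 * (4 * Nat.pair 0 (4 * Nat.pair (encode c)
        (encode [encodeTerm (numeral n), 0]) + 2) + 5) + 3 := by
    have hl : Primrec fun n : ℕ => encode [encodeTerm (numeral n), 0] :=
      Primrec.encode.comp
        (Primrec.list_cons.comp primrec_encodeTerm_numeral (Primrec.const [0]))
    have affine : ∀ (f : ℕ → ℕ) (k : ℕ), Primrec f → Primrec fun n => 4 * f n + k :=
      fun f k hf => Primrec.nat_add.comp (Primrec.nat_mul.comp (Primrec.const 4) hf)
        (Primrec.const k)
    exact affine _ 3 (affine _ 5 (Primrec₂.natPair.comp (Primrec.const 0)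
      (affine _ 2 (Primrec₂.natPair.comp (Primrec.const _) hl))))
  exact Primrec.encode_iff.1 (h.of_eq fun n => rfl)

/-- Only the head of the list depends on the input; the closed clauses are a constant, so computing
closures is never required. -/
theorem computable_divergenceTheory (c : Code) : Computable (divergenceTheory c) :=
  (Primrec.list_cons.comp (primrec_divergenceSentence c) (Primrec.const _)).to_comp

/-- A universal code turns the varying code into a varying input, which keeps the clauses of the
theory fixed. -/
theorem exists_code_eval_encode :
    ∃ u : Code, ∀ c : Code, u.eval (encode c) = c.eval 0 := by
  have h : Partrec fun n : ℕ => (Denumerable.ofNat Code n).eval 0 :=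
    Code.eval_part.comp (Computable.ofNat Code) (Computable.const 0)
  obtain ⟨u, hu⟩ := Code.exists_code.1 (Partrec.nat_iff.1 h)
  refine ⟨u, fun c => ?_⟩
  rw [hu]
  change (Denumerable.ofNat Code (encode c)).eval 0 = c.eval 0
  rw [Denumerable.ofNat_encode]

/-- The satisfiability of finite theories without rigid function symbols is undecidable. -/
theorem satisfiable_undecidable :
    ¬ ∃ alg : List (Formula fullLang) → Bool, Computable alg ∧
      ∀ T : List (Formula fullLang), IsTheory {σ | σ ∈ T} → NoRigid fullRigid {σ | σ ∈ T} →
        (alg T = true ↔ Satisfiable {σ | σ ∈ T}) := by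
  rintro ⟨alg, halg, h⟩
  obtain ⟨u, hu⟩ := exists_code_eval_encode
  -- Satisfiability means divergence, so the negated algorithm would decide halting at input 0.
  refine ComputablePred.halting_problem 0 (ComputablePred.computable_iff.2
    ⟨fun c => !alg (divergenceTheory u (encode c)), Primrec.not.to_comp.comp
      (halg.comp ((computable_divergenceTheory u).comp Computable.encode)), ?_⟩)
  funext c
  have := (h _ (isTheory_divergenceTheory u (encode c))
    (noRigid_divergenceTheory u (encode c))).trans (satisfiable_divergenceTheory u (encode c))
  rw [hu] at this
  rw [Bool.not_eq_true', ← Bool.not_eq_true, this, not_not]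

/-- Whether the trivial answer is the most specific answer to the trivial question entailed by a
finite theory without rigid function symbols is undecidable. -/
theorem isMostSpecificAnswer_top_undecidable :
    ¬ ∃ alg : List (Formula fullLang) → Bool, Computable alg ∧
      ∀ T : List (Formula fullLang), IsTheory {σ | σ ∈ T} → NoRigid fullRigid {σ | σ ∈ T} →
        (alg T = true ↔ IsMostSpecificAnswer fullRigid {σ | σ ∈ T} .top .top) := by
  rintro ⟨alg, halg, h⟩
  exact satisfiable_undecidable ⟨alg, halg, fun T hT hR =>
    (h T hT hR).trans (satisfiable_iff_isMostSpecificAnswer_top hR).symm⟩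

end Undecidability

end Arithmetic

end Answerhood

theorem mainTheorem7 :
    -- the reduction
    (∀ (L : FirstOrder.Language.{u, v}) (R : Set (Σ n, L.Functions n))
        (T : Set (Answerhood.Formula L)),
        Answerhood.IsTheory T → Answerhood.NoRigid R T →
        (Answerhood.Satisfiable T ↔ Answerhood.IsMostSpecificAnswer R T .top .top)) ∧
    -- undecidability
    (¬ ∃ alg : List (Answerhood.Formula Answerhood.fullLang) ×
          Answerhood.Formula Answerhood.fullLang × Answerhood.Formula Answerhood.fullLang → Bool,
        Computable alg ∧
        ∀ (T : List (Answerhood.Formula Answerhood.fullLang))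
          (φ ψ : Answerhood.Formula Answerhood.fullLang),
          Answerhood.IsTheory {σ | σ ∈ T} → ψ.IsSentence →
          (alg (T, φ, ψ) = true ↔
            Answerhood.IsMostSpecificAnswer Answerhood.fullRigid {σ | σ ∈ T} φ ψ)) ∧
    -- undecidability already of the instances that occur in the reduction
    (¬ ∃ alg : List (Answerhood.Formula Answerhood.fullLang) → Bool,
        Computable alg ∧
        ∀ T : List (Answerhood.Formula Answerhood.fullLang),
          Answerhood.IsTheory {σ | σ ∈ T} → Answerhood.NoRigid Answerhood.fullRigid {σ | σ ∈ T} →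
          (alg T = true ↔
            Answerhood.IsMostSpecificAnswer Answerhood.fullRigid {σ | σ ∈ T} .top .top)) := by
  refine ⟨fun L R T _ hR => Answerhood.satisfiable_iff_isMostSpecificAnswer_top hR, ?_,
    Answerhood.isMostSpecificAnswer_top_undecidable⟩
  rintro ⟨alg, halg, h⟩
  exact Answerhood.isMostSpecificAnswer_top_undecidable
    ⟨fun T => alg (T, .top, .top),
      halg.comp (Computable.id.pair (Computable.const (Answerhood.Formula.top, Answerhood.Formula.top))),
      fun T hT _ => h T .top .top hT rfl⟩
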